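/- Let $\mu\in(1/2,1)$, let $V_\mu=\{(r\cos\theta,r\sin\theta): r>0,\ 0<\theta<\mu\pi\}\subset\mathbb R^2$ be the open infinite cone with vertex at the origin and opening angle $\mu\pi$, and let $B_r$ denote the open disc of radius $r$ centred at the origin. Let $u\in C^2(\overline{V_\mu\cap B_1})$ be a real-valued function such that $$\det D^2u=1\ \text{ in } V_\mu\cap B_1,\qquad u=\frac{|x|^2}{2}\ \text{ on } \partial V_\mu\cap B_1,$$ and put $v=u-\frac{|x|^2}{2}$. Assume that $D^2v(0)=0$, and that there exists $\delta>0$ such that $v\le 0$ in $V_\mu\cap B_\delta$. Then $v\equiv 0$ on $\overline{V_\mu\cap B_1}$. -/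

import Mathlib

noncomputable section

/-- The infinite planar cone with vertex at the origin and opening angle `μ π`, in polar
coordinates `{(r, θ) | 0 < r, 0 < θ < μ π}`. -/
def cone (μ : ℝ) : Set (EuclideanSpace ℝ (Fin 2)) :=
  {x | ∃ r θ : ℝ, 0 < r ∧ 0 < θ ∧ θ < μ * Real.pi ∧ x = !₂[r * Real.cos θ, r * Real.sin θ]}

/-- The truncated cone: the points of the cone in the open unit disc. -/
def truncCone (μ : ℝ) : Set (EuclideanSpace ℝ (Fin 2)) :=
  cone μ ∩ Metric.ball 0 1

/-- The Hessian matrix `(∂ᵢ ∂ⱼ f (x))`. -/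
def hessian (f : EuclideanSpace ℝ (Fin 2) → ℝ) (x : EuclideanSpace ℝ (Fin 2)) :
    Matrix (Fin 2) (Fin 2) ℝ :=
  Matrix.of fun i j => iteratedFDeriv ℝ 2 f x
    ![EuclideanSpace.single i 1, EuclideanSpace.single j 1]

/-- The Hessian matrix at a point of a set `s`, with derivatives taken within `s`; for `f` of class
`C²` on the closure `s` of a convex open set, it is at boundary points the continuous extension of
the Hessian from the interior. -/
def hessianWithin (f : EuclideanSpace ℝ (Fin 2) → ℝ) (s : Set (EuclideanSpace ℝ (Fin 2)))
    (x : EuclideanSpace ℝ (Fin 2)) : Matrix (Fin 2) (Fin 2) ℝ :=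
  Matrix.of fun i j => iteratedFDerivWithin ℝ 2 f s x
    ![EuclideanSpace.single i 1, EuclideanSpace.single j 1]

end

/-! Since the Hessian of `u` is symmetric of determinant one, its squared trace is at least 4. The
trace is close to 2 near the vertex because `D²v(0) = 0`, so connectedness excludes the negative
branch. Hence `u` is convex and `v` is subharmonic.

At the vertex `v` is `o(|x|²)`: it vanishes along two independent edges, which kills the gradient,
and its Hessian is zero by hypothesis. An angle larger than `π/2` contains a slightly tilted
quadrant whose closed edges, apart from the vertex, lie in the open cone. The product `A B` of the
two orthogonal coordinates of that quadrant is a positive harmonic function of degree two. If `v`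
were negative throughout the cone near the vertex, comparison would give `v ≤ -c A B`, contradicting
`o(|x|²)` (`exists_eq_zero_of_isLittleO_sq`).

So `v` has an interior zero, and the strong maximum principle (`neg_of_neg_center`) makes `v` vanish
near it. This local vanishing propagates by Jörgens' transformation: with points and gradients read
as complex numbers, the conjugate of `x - ∇u` is a holomorphic function of `x + ∇u`, so the identity
theorem applies (`fderiv_eq_of_det_hessian_eq_one`). Thus `∇v = 0` in the truncated cone, and
continuity reaches the closure. -/

open Set Filter Topology

/-! ### Second-order calculus for the Hessian matrix -/

/-- Pure second derivatives are second derivatives along lines. -/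
theorem iteratedFDeriv_two_eq_deriv_deriv {E : Type*} [NormedAddCommGroup E] [NormedSpace ℝ E]
    {f : E → ℝ} {x : E} (hf : ContDiffAt ℝ 2 f x) (e : E) :
    iteratedFDeriv ℝ 2 f x ![e, e] = deriv (deriv fun t : ℝ => f (x + t • e)) 0 := by
  have hline : ∀ t : ℝ, HasDerivAt (fun t : ℝ => x + t • e) e t := fun t => by
    simpa using ((hasDerivAt_id t).smul_const e).const_add x
  have hcont : Tendsto (fun t : ℝ => x + t • e) (𝓝 0) (𝓝 x) := by
    have := (hline 0).continuousAt.tendsto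
    simpa using this
  have hev : ∀ᶠ t : ℝ in 𝓝 0, ContDiffAt ℝ 2 f (x + t • e) :=
    hcont.eventually (hf.eventually (by simp))
  have h1 : (deriv fun t : ℝ => f (x + t • e)) =ᶠ[𝓝 0] fun t => fderiv ℝ f (x + t • e) e := by
    filter_upwards [hev] with t ht
    exact ((ht.differentiableAt (by simp)).hasFDerivAt.comp_hasDerivAt t (hline t)).deriv
  rw [h1.deriv_eq, iteratedFDeriv_two_apply]
  have h2 : DifferentiableAt ℝ (fderiv ℝ f) (x + (0 : ℝ) • e) := by
    rw [zero_smul, add_zero]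
    exact (hf.fderiv_right (m := 1) (by norm_num)).differentiableAt (by simp)
  have h3 : HasDerivAt (fun t : ℝ => fderiv ℝ f (x + t • e))
      (fderiv ℝ (fderiv ℝ f) (x + (0 : ℝ) • e) e) 0 :=
    h2.hasFDerivAt.comp_hasDerivAt 0 (hline 0)
  have h4 : HasDerivAt (fun t : ℝ => fderiv ℝ f (x + t • e) e)
      (fderiv ℝ (fderiv ℝ f) (x + (0 : ℝ) • e) e e) 0 :=
    (ContinuousLinearMap.apply ℝ ℝ e).hasFDerivAt.comp_hasDerivAt 0 h3
  rw [h4.deriv, zero_smul, add_zero]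
  rfl

/-- Necessary second-order condition at a local maximum on the line. -/
theorem IsLocalMax.deriv_deriv_nonpos {f : ℝ → ℝ} {a : ℝ} (h : IsLocalMax f a)
    (hc : ContinuousAt f a) : deriv (deriv f) a ≤ 0 := by
  by_contra! hpos
  -- A strictly positive second derivative would make `a` a local minimum as well, so `f` would be
  -- locally constant.
  have hmin := isLocalMin_of_deriv_deriv_pos hpos h.deriv_eq_zero hc
  have heq : f =ᶠ[𝓝 a] fun _ => f a := by
    filter_upwards [h, hmin] with y h1 h2 using le_antisymm h1 h2
  have h0 : deriv (deriv f) a = 0 := by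
    rw [heq.deriv.deriv_eq]
    simp
  exact absurd hpos (by simp [h0])

theorem hessian_add {f g : EuclideanSpace ℝ (Fin 2) → ℝ} {x : EuclideanSpace ℝ (Fin 2)}
    (hf : ContDiffAt ℝ 2 f x) (hg : ContDiffAt ℝ 2 g x) :
    hessian (fun y => f y + g y) x = hessian f x + hessian g x := by
  ext i j
  have : (fun y => f y + g y) = f + g := rfl
  simp only [hessian, Matrix.of_apply, Matrix.add_apply, this]
  rw [iteratedFDeriv_add_apply (by exact_mod_cast hf) (by exact_mod_cast hg)]
  rfl

theorem hessian_const_mul {f : EuclideanSpace ℝ (Fin 2) → ℝ} {x : EuclideanSpace ℝ (Fin 2)}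
    (hf : ContDiffAt ℝ 2 f x) (c : ℝ) :
    hessian (fun y => c * f y) x = c • hessian f x := by
  ext i j
  have : (fun y => c * f y) = c • f := rfl
  simp only [hessian, Matrix.of_apply, Matrix.smul_apply, this]
  rw [iteratedFDeriv_const_smul_apply (by exact_mod_cast hf)]
  rfl

theorem trace_hessian_eq {f : EuclideanSpace ℝ (Fin 2) → ℝ} {x : EuclideanSpace ℝ (Fin 2)}
    (hf : ContDiffAt ℝ 2 f x) :
    (hessian f x).trace =
      deriv (deriv fun t : ℝ => f (x + t • EuclideanSpace.single 0 1)) 0 +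
        deriv (deriv fun t : ℝ => f (x + t • EuclideanSpace.single 1 1)) 0 := by
  rw [← iteratedFDeriv_two_eq_deriv_deriv hf, ← iteratedFDeriv_two_eq_deriv_deriv hf]
  simp [Matrix.trace_fin_two, hessian]

theorem IsLocalMax.trace_hessian_nonpos {f : EuclideanSpace ℝ (Fin 2) → ℝ}
    {x : EuclideanSpace ℝ (Fin 2)} (h : IsLocalMax f x) (hf : ContDiffAt ℝ 2 f x) :
    (hessian f x).trace ≤ 0 := by
  have key : ∀ e : EuclideanSpace ℝ (Fin 2),
      deriv (deriv fun t : ℝ => f (x + t • e)) 0 ≤ 0 := by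
    intro e
    have hc : ContinuousAt (fun t : ℝ => x + t • e) 0 := by fun_prop
    have hmax : IsLocalMax (fun t : ℝ => f (x + t • e)) 0 := by
      have h' : IsLocalMax f (x + (0 : ℝ) • e) := by simpa using h
      exact IsLocalMax.comp_continuous (g := fun t : ℝ => x + t • e) h' hc
    refine hmax.deriv_deriv_nonpos ?_
    refine ContinuousAt.comp (g := f) ?_ hc
    simpa using hf.continuousAt
  rw [trace_hessian_eq hf]
  exact add_nonpos (key _) (key _)

/-! ### Model functions used in comparisons -/

theorem contDiff_coord (i : Fin 2) :
    ContDiff ℝ 2 fun y : EuclideanSpace ℝ (Fin 2) => y i := by fun_prop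

/-- Serves two purposes: orthogonal `a`, `b` give a harmonic product, and `a = b` a coordinate
vector gives the summands of `|x|²`. -/
theorem trace_hessian_linear_mul_linear (a b : EuclideanSpace ℝ (Fin 2))
    (x : EuclideanSpace ℝ (Fin 2)) :
    (hessian (fun y => (a 0 * y 0 + a 1 * y 1) * (b 0 * y 0 + b 1 * y 1)) x).trace =
      2 * (a 0 * b 0 + a 1 * b 1) := by
  have quad : ∀ p q r s : ℝ, deriv (deriv fun t : ℝ => (p + q * t) * (r + s * t)) 0 = 2 * (q * s) := by
    intro p q r s
    have lin : ∀ p q t : ℝ, HasDerivAt (fun t : ℝ => p + q * t) q t := fun p q t => by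
      simpa using ((hasDerivAt_id t).const_mul q).const_add p
    have h1 : (deriv fun t : ℝ => (p + q * t) * (r + s * t)) =
        fun t => (q * r + p * s) + 2 * (q * s) * t := by
      funext t
      have h : HasDerivAt (fun t : ℝ => (p + q * t) * (r + s * t))
          (q * (r + s * t) + (p + q * t) * s) t := (lin p q t).mul (lin r s t)
      rw [h.deriv]
      ring
    rw [h1, (lin _ _ 0).deriv]
  rw [trace_hessian_eq]
  · have e0 := quad (a 0 * x 0 + a 1 * x 1) (a 0) (b 0 * x 0 + b 1 * x 1) (b 0)
    have e1 := quad (a 0 * x 0 + a 1 * x 1) (a 1) (b 0 * x 0 + b 1 * x 1) (b 1)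
    rw [mul_add, ← e0, ← e1]
    congr 1 <;> congr 2 <;> funext t <;> simp <;> ring
  · have h0 := contDiff_coord 0
    have h1 := contDiff_coord 1
    fun_prop

/-- In the plane `Δ|x - p|⁻² = 4|x - p|⁻⁴`. This subharmonic, radially decreasing function is the
barrier for the strong maximum principle. -/
theorem trace_hessian_inv_dist_sq {p x : EuclideanSpace ℝ (Fin 2)} (hx : x ≠ p) :
    ContDiffAt ℝ 2 (fun y : EuclideanSpace ℝ (Fin 2) =>
        ((y 0 - p 0) ^ 2 + (y 1 - p 1) ^ 2)⁻¹) x ∧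
      0 ≤ (hessian (fun y : EuclideanSpace ℝ (Fin 2) =>
        ((y 0 - p 0) ^ 2 + (y 1 - p 1) ^ 2)⁻¹) x).trace := by
  have hN : (x 0 - p 0) ^ 2 + (x 1 - p 1) ^ 2 ≠ 0 := by
    intro h
    apply hx
    have h0 : x 0 - p 0 = 0 := by nlinarith [sq_nonneg (x 0 - p 0), sq_nonneg (x 1 - p 1)]
    have h1 : x 1 - p 1 = 0 := by nlinarith [sq_nonneg (x 0 - p 0), sq_nonneg (x 1 - p 1)]
    ext i
    fin_cases i
    · exact sub_eq_zero.mp h0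
    · exact sub_eq_zero.mp h1
  have hC : ContDiffAt ℝ 2 (fun y : EuclideanSpace ℝ (Fin 2) =>
        ((y 0 - p 0) ^ 2 + (y 1 - p 1) ^ 2)⁻¹) x := by
    refine ContDiffAt.inv ?_ hN
    have h0 := contDiff_coord 0
    have h1 := contDiff_coord 1
    fun_prop
  refine ⟨hC, ?_⟩
  have slice : ∀ α β : ℝ, α ^ 2 + β ≠ 0 →
      deriv (deriv fun t : ℝ => ((α + t) ^ 2 + β)⁻¹) 0 =
        -2 / (α ^ 2 + β) ^ 2 + 8 * α ^ 2 / (α ^ 2 + β) ^ 3 := by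
    intro α β h
    have hd : ∀ t : ℝ, HasDerivAt (fun t : ℝ => (α + t) ^ 2 + β) (2 * (α + t)) t := fun t => by
      simpa using ((((hasDerivAt_id t).const_add α).pow 2).add_const β)
    have hev : ∀ᶠ t : ℝ in 𝓝 0, (α + t) ^ 2 + β ≠ 0 := by
      refine (hd 0).continuousAt.eventually_ne ?_
      simpa using h
    have h1 : (deriv fun t : ℝ => ((α + t) ^ 2 + β)⁻¹) =ᶠ[𝓝 0]
        fun t => -2 * (α + t) / ((α + t) ^ 2 + β) ^ 2 := by
      filter_upwards [hev] with t ht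
      rw [neg_mul]
      exact ((hd t).inv ht).deriv
    rw [h1.deriv_eq]
    have hl : HasDerivAt (fun t : ℝ => -2 * (α + t)) (-2) 0 := by
      simpa using ((hasDerivAt_id (0 : ℝ)).const_add α).const_mul (-2)
    have h2 := (hl.div ((hd 0).pow 2) (by simpa using h)).deriv
    simp only [Pi.div_def, Pi.pow_def] at h2
    rw [h2]
    simp only [add_zero]
    field_simp
    ring
  rw [trace_hessian_eq hC]
  have s0 := slice (x 0 - p 0) ((x 1 - p 1) ^ 2) hN
  have s1 := slice (x 1 - p 1) ((x 0 - p 0) ^ 2) (by rwa [add_comm])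
  have e0 : (fun t : ℝ => (((x + t • EuclideanSpace.single (0 : Fin 2) (1 : ℝ)) 0 - p 0) ^ 2 +
      ((x + t • EuclideanSpace.single (0 : Fin 2) (1 : ℝ)) 1 - p 1) ^ 2)⁻¹) =
      fun t => ((x 0 - p 0 + t) ^ 2 + (x 1 - p 1) ^ 2)⁻¹ := by
    funext t
    simp [sub_add_eq_add_sub]
  have e1 : (fun t : ℝ => (((x + t • EuclideanSpace.single (1 : Fin 2) (1 : ℝ)) 0 - p 0) ^ 2 +
      ((x + t • EuclideanSpace.single (1 : Fin 2) (1 : ℝ)) 1 - p 1) ^ 2)⁻¹) =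
      fun t => ((x 1 - p 1 + t) ^ 2 + (x 0 - p 0) ^ 2)⁻¹ := by
    funext t
    rw [add_comm]
    simp [sub_add_eq_add_sub]
  rw [e0, e1, s0, s1, add_comm ((x 1 - p 1) ^ 2)]
  have hpos : 0 < (x 0 - p 0) ^ 2 + (x 1 - p 1) ^ 2 := lt_of_le_of_ne (by positivity) hN.symm
  generalize x 0 - p 0 = A at *
  generalize x 1 - p 1 = B at *
  have : -2 / (A ^ 2 + B ^ 2) ^ 2 + 8 * A ^ 2 / (A ^ 2 + B ^ 2) ^ 3 +
      (-2 / (A ^ 2 + B ^ 2) ^ 2 + 8 * B ^ 2 / (A ^ 2 + B ^ 2) ^ 3) = 4 / (A ^ 2 + B ^ 2) ^ 2 := by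
    field_simp
    ring
  rw [this]
  positivity

/-! ### Maximum principles -/

/-- Weak maximum principle for functions with nonnegative Laplacian. -/
theorem nonpos_of_trace_hessian_nonneg {f : EuclideanSpace ℝ (Fin 2) → ℝ}
    {K U : Set (EuclideanSpace ℝ (Fin 2))} (hK : IsCompact K) (hU : IsOpen U) (hUK : U ⊆ K)
    (hfc : ContinuousOn f K) (hf : ∀ x ∈ U, ContDiffAt ℝ 2 f x)
    (hΔ : ∀ x ∈ U, 0 ≤ (hessian f x).trace) (hb : ∀ x ∈ K, x ∉ U → f x ≤ 0) :
    ∀ x ∈ K, f x ≤ 0 := by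
  by_contra! hcon
  obtain ⟨x₁, hx₁, hpos⟩ := hcon
  set q : EuclideanSpace ℝ (Fin 2) → ℝ := fun y =>
    ((1 * y 0 + 0 * y 1) * (1 * y 0 + 0 * y 1)) + ((0 * y 0 + 1 * y 1) * (0 * y 0 + 1 * y 1)) with hq
  have hqC : ContDiff ℝ 2 q := by
    have h0 := contDiff_coord 0
    have h1 := contDiff_coord 1
    fun_prop
  have hq0 : ∀ y, 0 ≤ q y := fun y => add_nonneg (mul_self_nonneg _) (mul_self_nonneg _)
  have hqΔ : ∀ y, (hessian q y).trace = 4 := by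
    intro y
    have h0 := contDiff_coord 0
    have h1 := contDiff_coord 1
    have t0 := trace_hessian_linear_mul_linear !₂[1, 0] !₂[1, 0] y
    have t1 := trace_hessian_linear_mul_linear !₂[0, 1] !₂[0, 1] y
    simp only [Matrix.cons_val_zero, Matrix.cons_val_one] at t0 t1
    rw [hq, hessian_add (by fun_prop) (by fun_prop), Matrix.trace_add, t0, t1]
    norm_num
  obtain ⟨M, hM⟩ := hK.exists_bound_of_continuousOn hqC.continuous.continuousOn
  have hM0 : 0 ≤ M := (norm_nonneg _).trans (hM x₁ hx₁)
  -- Adding `ε|y|²` makes the Laplacian strictly positive; `ε` is small enough that the perturbed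
  -- maximum stays in `U`.
  set ε := f x₁ / (2 * (M + 1)) with hε
  have hε0 : 0 < ε := by positivity
  have hεM : ε * M < f x₁ := by
    rw [hε, div_mul_eq_mul_div, div_lt_iff₀ (by positivity)]
    nlinarith
  obtain ⟨x₂, hx₂, hmax⟩ := hK.exists_isMaxOn ⟨x₁, hx₁⟩
    (hfc.add (continuousOn_const.mul hqC.continuous.continuousOn) :
      ContinuousOn (fun y => f y + ε * q y) K)
  have h12 : f x₁ + ε * q x₁ ≤ f x₂ + ε * q x₂ := hmax hx₁
  have hx₂U : x₂ ∈ U := by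
    by_contra hn
    have h1 := hb x₂ hx₂ hn
    have h2 : ε * q x₂ ≤ ε * M :=
      mul_le_mul_of_nonneg_left ((le_abs_self _).trans (hM x₂ hx₂)) hε0.le
    have h3 := mul_nonneg hε0.le (hq0 x₁)
    linarith
  have hloc : IsLocalMax (fun y => f y + ε * q y) x₂ :=
    hmax.isLocalMax (mem_of_superset (hU.mem_nhds hx₂U) hUK)
  have hεq : ContDiffAt ℝ 2 (fun y => ε * q y) x₂ := (contDiff_const.mul hqC).contDiffAt
  have hle := hloc.trace_hessian_nonpos ((hf x₂ hx₂U).add hεq)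
  rw [hessian_add (hf x₂ hx₂U) hεq, hessian_const_mul hqC.contDiffAt, Matrix.trace_add,
    Matrix.trace_smul, hqΔ, smul_eq_mul] at hle
  have := hΔ x₂ hx₂U
  linarith

theorem dist_sq_eq_coord (x y : EuclideanSpace ℝ (Fin 2)) :
    dist x y ^ 2 = (x 0 - y 0) ^ 2 + (x 1 - y 1) ^ 2 := by
  rw [EuclideanSpace.dist_eq, Real.sq_sqrt (by positivity)]
  simp [Fin.sum_univ_two, Real.dist_eq, sq_abs]

/-- Strong maximum principle: negativity at the centre of a disc spreads to the whole disc. -/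
theorem neg_of_neg_center {f : EuclideanSpace ℝ (Fin 2) → ℝ} {p : EuclideanSpace ℝ (Fin 2)} {R : ℝ}
    (hf : ∀ x ∈ Metric.closedBall p R, ContDiffAt ℝ 2 f x)
    (hΔ : ∀ x ∈ Metric.closedBall p R, 0 ≤ (hessian f x).trace)
    (hle : ∀ x ∈ Metric.closedBall p R, f x ≤ 0) (hp : f p < 0) :
    ∀ x ∈ Metric.ball p R, f x < 0 := by
  intro x hx
  have hR : 0 < R := dist_nonneg.trans_lt hx
  have hcp : ContinuousAt f p := (hf p (Metric.mem_closedBall_self hR.le)).continuousAt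
  obtain ⟨r, hr0, hr⟩ := Metric.eventually_nhds_iff.mp
    (hcp.eventually (gt_mem_nhds (show f p < f p / 2 by linarith)))
  set ρ := min (r / 2) (R / 2)
  have hρ0 : 0 < ρ := by positivity
  have hρr : ρ < r := (min_le_left _ _).trans_lt (by linarith)
  have hρR : ρ < R := (min_le_right _ _).trans_lt (by linarith)
  by_cases hxρ : dist x p ≤ ρ
  · have := hr (hxρ.trans_lt hρr)
    linarith
  push Not at hxρ
  -- On the circle of radius `ρ`, `f < f p / 2`, and this `c` makes `c ρ⁻²` equal to `-(f p / 2)`.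
  -- Subtracting `c R⁻²` makes the barrier vanish on the outer circle, so `g ≤ 0` on both boundary
  -- circles of the annulus.
  set c := -(f p / 2) * ρ ^ 2 with hc
  have hc0 : 0 < c := by
    have : 0 < ρ ^ 2 := by positivity
    nlinarith
  set N : EuclideanSpace ℝ (Fin 2) → ℝ := fun y => ((y 0 - p 0) ^ 2 + (y 1 - p 1) ^ 2)⁻¹ with hN
  have hNd : ∀ y, N y = (dist y p ^ 2)⁻¹ := fun y => by rw [dist_sq_eq_coord]
  set g : EuclideanSpace ℝ (Fin 2) → ℝ := fun y => f y + (c * N y + -(c * (R ^ 2)⁻¹)) with hg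
  have hconst : ∀ (k : ℝ) (y : EuclideanSpace ℝ (Fin 2)),
      hessian (fun _ => k) y = 0 := by
    intro k y
    ext i j
    simp [hessian, iteratedFDeriv_two_apply]
  have hgC : ∀ y ∈ Metric.closedBall p R, y ≠ p →
      ContDiffAt ℝ 2 g y ∧ 0 ≤ (hessian g y).trace := by
    intro y hy hyp
    obtain ⟨h1, h2⟩ := trace_hessian_inv_dist_sq hyp
    have h3 : ContDiffAt ℝ 2 (fun y => c * N y) y := contDiffAt_const.mul h1
    refine ⟨(hf y hy).add (h3.add contDiffAt_const), ?_⟩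
    rw [hg, hessian_add (hf y hy) (h3.add contDiffAt_const), hessian_add h3 contDiffAt_const,
      hessian_const_mul h1, hconst, add_zero, Matrix.trace_add, Matrix.trace_smul, smul_eq_mul]
    exact add_nonneg (hΔ y hy) (mul_nonneg hc0.le h2)
  have hKsub : ∀ y ∈ Metric.closedBall p R \ Metric.ball p ρ, y ≠ p := by
    rintro y ⟨-, hy⟩ rfl
    exact hy (Metric.mem_ball_self hρ0)
  have hmain := nonpos_of_trace_hessian_nonneg (f := g) (K := Metric.closedBall p R \ Metric.ball p ρ)
    (U := Metric.ball p R \ Metric.closedBall p ρ)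
    ((isCompact_closedBall p R).diff Metric.isOpen_ball)
    (Metric.isOpen_ball.sdiff Metric.isClosed_closedBall)
    (sdiff_subset_sdiff Metric.ball_subset_closedBall Metric.ball_subset_closedBall)
    (fun y hy => (hgC y hy.1 (hKsub y hy)).1.continuousAt.continuousWithinAt)
    (fun y hy => (hgC y (Metric.ball_subset_closedBall hy.1)
      (hKsub y ⟨Metric.ball_subset_closedBall hy.1, fun h =>
        hy.2 (Metric.ball_subset_closedBall h)⟩)).1)
    (fun y hy => (hgC y (Metric.ball_subset_closedBall hy.1)
      (hKsub y ⟨Metric.ball_subset_closedBall hy.1, fun h =>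
        hy.2 (Metric.ball_subset_closedBall h)⟩)).2) ?_
  · have h1 := hmain x ⟨Metric.ball_subset_closedBall hx, fun h => hxρ.not_gt h⟩
    simp only [hg, hNd] at h1
    have h2 : (R ^ 2)⁻¹ < (dist x p ^ 2)⁻¹ := by
      have hd : 0 < dist x p := hρ0.trans hxρ
      have : dist x p < R := hx
      gcongr
    nlinarith
  · rintro y ⟨hy1, hy2⟩ hyU
    simp only [hg, hNd]
    by_cases hyR : dist y p < R
    · have hyρ : dist y p = ρ := by
        have h1 : dist y p ≤ ρ := by
          by_contra h
          exact hyU ⟨hyR, fun h' => h h'⟩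
        exact le_antisymm h1 (not_lt.mp fun h => hy2 h)
      have h1 := hr (hyρ.trans_lt hρr)
      rw [hyρ, hc]
      have h2 : 0 < (R ^ 2)⁻¹ := by positivity
      have h3 : -(f p / 2) * ρ ^ 2 * (ρ ^ 2)⁻¹ = -(f p / 2) := by field_simp
      have h4 : 0 < c * (R ^ 2)⁻¹ := by positivity
      rw [hc] at h4
      linarith
    · have hyR' : dist y p = R := le_antisymm hy1 (not_lt.mp hyR)
      rw [hyR']
      have := hle y hy1
      linarith

/-! ### Unique continuation and Jörgens' transformation -/

/-- If `W` depends holomorphically on a local complex coordinate `ζ`, then `W` vanishes on a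
connected open set as soon as it vanishes near one of its points. -/
theorem eqOn_zero_of_fderiv_eq_mul {E : Type*} [NormedAddCommGroup E] [NormedSpace ℝ E]
    [FiniteDimensional ℝ E] (hE : Module.finrank ℝ E = 2) {O : Set E} (hO : IsOpen O)
    (hOc : IsPreconnected O) {ζ W : E → ℂ} (hζ : ∀ x ∈ O, ContDiffAt ℝ 1 ζ x)
    (hW : ∀ x ∈ O, DifferentiableAt ℝ W x)
    (hinj : ∀ x ∈ O, ∀ y, fderiv ℝ ζ x y = 0 → y = 0)
    (hmul : ∀ x ∈ O, ∃ c : ℂ, ∀ y, fderiv ℝ W x y = c * fderiv ℝ ζ x y)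
    {x₀ : E} (hx₀ : x₀ ∈ O) (h0 : ∀ᶠ x in 𝓝 x₀, W x = 0) : ∀ x ∈ O, W x = 0 := by
  have : CompleteSpace E := FiniteDimensional.complete ℝ E
  have hequiv : ∀ x ∈ O, ∃ e : E ≃L[ℝ] ℂ, (e : E →L[ℝ] ℂ) = fderiv ℝ ζ x := by
    intro x hx
    have hi : Function.Injective (fderiv ℝ ζ x : E →ₗ[ℝ] ℂ) := by
      rw [← LinearMap.ker_eq_bot, LinearMap.ker_eq_bot']
      exact hinj x hx
    refine ⟨(LinearEquiv.ofInjectiveOfFinrankEq _ hi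
      (by rw [hE, Complex.finrank_real_complex])).toContinuousLinearEquiv, ?_⟩
    ext y
    rfl
  set S : Set E := {x | ∀ᶠ y in 𝓝 x, W y = 0} with hS
  have hSo : IsOpen S := isOpen_setOfPred_eventually_nhds
  suffices hsub : O ⊆ S from fun x hx => (hsub hx).self_of_nhds
  -- The set `S` is open, so it remains to show that it is closed relative to `O`.
  refine hOc.subset_of_closure_inter_subset hSo ⟨x₀, hx₀, h0⟩ ?_
  rintro x ⟨hxS, hxO⟩
  obtain ⟨e, he⟩ := hequiv x hxO
  have hstrict : HasStrictFDerivAt ζ (e : E →L[ℝ] ℂ) x := by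
    rw [he]
    exact (hζ x hxO).hasStrictFDerivAt (by simp)
  set P := hstrict.toOpenPartialHomeomorph ζ with hP
  have hPζ : ∀ y, P y = ζ y := fun y => rfl
  have hxP : x ∈ P.source := hstrict.mem_toOpenPartialHomeomorph_source
  have hT : IsOpen (P.target ∩ P.symm ⁻¹' O) := P.isOpen_inter_preimage_symm hO
  have hζT : P x ∈ P.target ∩ P.symm ⁻¹' O :=
    ⟨P.map_source hxP, by simpa [P.left_inv hxP] using hxO⟩
  obtain ⟨r, hr, hball⟩ := Metric.isOpen_iff.mp hT _ hζT
  -- In the chart `ζ` the derivative of `W` is `DW ∘ (Dζ)⁻¹`, which is multiplication by `c` and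
  -- hence complex linear.
  have hdiff : DifferentiableOn ℂ (fun w => W (P.symm w)) (Metric.ball (P x) r) := by
    intro w hw
    obtain ⟨hw1, hw2⟩ := hball hw
    obtain ⟨e', he'⟩ := hequiv _ hw2
    obtain ⟨c, hc⟩ := hmul _ hw2
    have h1 : HasFDerivAt P.symm (e'.symm : ℂ →L[ℝ] E) w := by
      refine P.hasFDerivAt_symm hw1 ?_
      rw [he']
      exact ((hζ _ hw2).differentiableAt (by simp)).hasFDerivAt
    have h2 := (hW _ hw2).hasFDerivAt.comp w h1
    refine (HasFDerivAt.differentiableAt (f' := ContinuousLinearMap.smulRight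
      (1 : ℂ →L[ℂ] ℂ) c) ?_).differentiableWithinAt
    refine hasFDerivAt_of_restrictScalars ℝ h2 ?_
    ext z
    have hz : fderiv ℝ ζ (P.symm w) (e'.symm z) = z := by
      rw [← he']
      exact e'.apply_symm_apply z
    simp [hc, hz, mul_comm]
  have hana := hdiff.analyticOnNhd Metric.isOpen_ball
  have hnhd : P.source ∩ P ⁻¹' Metric.ball (P x) r ∈ 𝓝 x :=
    (P.isOpen_inter_preimage Metric.isOpen_ball).mem_nhds ⟨hxP, Metric.mem_ball_self hr⟩
  obtain ⟨y, ⟨hyP, hyB⟩, hyS⟩ := mem_closure_iff_nhds.mp hxS _ hnhd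
  have hev : (fun w => W (P.symm w)) =ᶠ[𝓝 (P y)] 0 := by
    have hc := P.continuousAt_symm (P.map_source hyP)
    have hyS' : ∀ᶠ z in 𝓝 (P.symm (P y)), W z = 0 := by rwa [P.left_inv hyP]
    exact hc.eventually hyS'
  have hzero := hana.eqOn_zero_of_preconnected_of_eventuallyEq_zero
    (convex_ball _ _).isPreconnected hyB hev
  filter_upwards [hnhd] with z hz
  have := hzero hz.2
  simpa [P.left_inv hz.1] using this

/-- A linear map on the plane in coordinates. -/
theorem EuclideanSpace.map_fin_two {F : Type*} [AddCommGroup F] [Module ℝ F]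
    [TopologicalSpace F] (L : EuclideanSpace ℝ (Fin 2) →L[ℝ] F) (y : EuclideanSpace ℝ (Fin 2)) :
    L y = y 0 • L (EuclideanSpace.single 0 1) + y 1 • L (EuclideanSpace.single 1 1) := by
  conv_lhs => rw [show y = y 0 • EuclideanSpace.single (0 : Fin 2) (1 : ℝ) +
    y 1 • EuclideanSpace.single (1 : Fin 2) (1 : ℝ) by ext i; fin_cases i <;> simp]
  simp

/-- Jörgens' transformation: a convex `C²` solution of `det D²u = 1` on a connected open planar
set whose gradient is `x` near one point has gradient `x` everywhere. -/
theorem fderiv_eq_of_det_hessian_eq_one {u : EuclideanSpace ℝ (Fin 2) → ℝ}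
    {O : Set (EuclideanSpace ℝ (Fin 2))} (hO : IsOpen O) (hOc : IsPreconnected O)
    (hu : ∀ x ∈ O, ContDiffAt ℝ 2 u x) (hdet : ∀ x ∈ O, (hessian u x).det = 1)
    (htr : ∀ x ∈ O, 0 < (hessian u x).trace)
    {x₀ : EuclideanSpace ℝ (Fin 2)} (hx₀ : x₀ ∈ O)
    (h0 : ∀ᶠ x in 𝓝 x₀, ∀ i, fderiv ℝ u x (EuclideanSpace.single i 1) = x i) :
    ∀ x ∈ O, ∀ i, fderiv ℝ u x (EuclideanSpace.single i 1) = x i := by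
  set e : Fin 2 → EuclideanSpace ℝ (Fin 2) := fun i => EuclideanSpace.single i 1 with he
  set p : Fin 2 → EuclideanSpace ℝ (Fin 2) → ℝ := fun i x => fderiv ℝ u x (e i) with hp
  have hfd : ∀ x ∈ O, ContDiffAt ℝ 1 (fderiv ℝ u) x := fun x hx =>
    (hu x hx).fderiv_right (by norm_num)
  have hpC : ∀ x ∈ O, ∀ i, ContDiffAt ℝ 1 (p i) x := fun x hx i =>
    (hfd x hx).clm_apply contDiffAt_const
  have hpD : ∀ x ∈ O, ∀ i, HasFDerivAt (p i)
      ((fderiv ℝ (fderiv ℝ u) x).flip (e i)) x := by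
    intro x hx i
    have h := ((hfd x hx).differentiableAt (by simp)).hasFDerivAt
    exact (ContinuousLinearMap.apply ℝ ℝ (e i)).hasFDerivAt.comp x h
  have hH : ∀ x i j, fderiv ℝ (fderiv ℝ u) x (e i) (e j) = hessian u x i j := by
    intro x i j
    simp [hessian, iteratedFDeriv_two_apply, he]
  have hsymm : ∀ x ∈ O, hessian u x 1 0 = hessian u x 0 1 := by
    intro x hx
    rw [← hH, ← hH]
    exact ((hu x hx).isSymmSndFDerivAt (by simp)) _ _
  have hcoord : ∀ (x : EuclideanSpace ℝ (Fin 2)) (i : Fin 2), HasFDerivAt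
      (fun y : EuclideanSpace ℝ (Fin 2) => y i) (EuclideanSpace.proj i : _ →L[ℝ] ℝ) x :=
    fun x i => (EuclideanSpace.proj i : EuclideanSpace ℝ (Fin 2) →L[ℝ] ℝ).hasFDerivAt
  -- As complex numbers, `ζ = x + ∇u` and `W` is the conjugate of `x - ∇u`.
  set ζ : EuclideanSpace ℝ (Fin 2) → ℂ := fun x =>
    ((x 0 + p 0 x : ℝ) : ℂ) + ((x 1 + p 1 x : ℝ) : ℂ) * Complex.I with hζ
  set W : EuclideanSpace ℝ (Fin 2) → ℂ := fun x =>
    ((x 0 - p 0 x : ℝ) : ℂ) - ((x 1 - p 1 x : ℝ) : ℂ) * Complex.I with hWdef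
  have hζd : ∀ x ∈ O, HasFDerivAt ζ
      (Complex.ofRealCLM.comp (EuclideanSpace.proj 0 + (fderiv ℝ (fderiv ℝ u) x).flip (e 0)) +
        (Complex.ofRealCLM.comp (EuclideanSpace.proj 1 +
          (fderiv ℝ (fderiv ℝ u) x).flip (e 1))).smulRight Complex.I) x := by
    intro x hx
    exact (Complex.ofRealCLM.hasFDerivAt.comp x ((hcoord x 0).add (hpD x hx 0))).add
      (((Complex.ofRealCLM.hasFDerivAt.comp x ((hcoord x 1).add (hpD x hx 1)))).mul_const'
        Complex.I)
  have hWd : ∀ x ∈ O, HasFDerivAt W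
      (Complex.ofRealCLM.comp (EuclideanSpace.proj 0 - (fderiv ℝ (fderiv ℝ u) x).flip (e 0)) -
        (Complex.ofRealCLM.comp (EuclideanSpace.proj 1 -
          (fderiv ℝ (fderiv ℝ u) x).flip (e 1))).smulRight Complex.I) x := by
    intro x hx
    exact (Complex.ofRealCLM.hasFDerivAt.comp x ((hcoord x 0).sub (hpD x hx 0))).sub
      (((Complex.ofRealCLM.hasFDerivAt.comp x ((hcoord x 1).sub (hpD x hx 1)))).mul_const'
        Complex.I)
  have hflip : ∀ x y i, (fderiv ℝ (fderiv ℝ u) x).flip (e i) y =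
      hessian u x 0 i * y 0 + hessian u x 1 i * y 1 := by
    intro x y i
    rw [EuclideanSpace.map_fin_two ((fderiv ℝ (fderiv ℝ u) x).flip (e i)) y,
      ContinuousLinearMap.flip_apply, ContinuousLinearMap.flip_apply, ← hH, ← hH]
    simp only [he, smul_eq_mul]
    ring
  have hζy : ∀ x ∈ O, ∀ y, fderiv ℝ ζ x y =
      ⟨(1 + hessian u x 0 0) * y 0 + hessian u x 0 1 * y 1,
        hessian u x 0 1 * y 0 + (1 + hessian u x 1 1) * y 1⟩ := by
    intro x hx y
    rw [(hζd x hx).fderiv]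
    apply Complex.ext <;>
    simp [hflip, hsymm x hx, -ContinuousLinearMap.flip_apply] <;> ring
  have hWy : ∀ x ∈ O, ∀ y, fderiv ℝ W x y =
      ⟨(1 - hessian u x 0 0) * y 0 - hessian u x 0 1 * y 1,
        hessian u x 0 1 * y 0 - (1 - hessian u x 1 1) * y 1⟩ := by
    intro x hx y
    rw [(hWd x hx).fderiv]
    apply Complex.ext <;>
    simp [hflip, hsymm x hx, -ContinuousLinearMap.flip_apply] <;> ring
  have hdet' : ∀ x ∈ O, hessian u x 0 0 * hessian u x 1 1 - hessian u x 0 1 ^ 2 = 1 := by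
    intro x hx
    have := hdet x hx
    rw [Matrix.det_fin_two, hsymm x hx] at this
    linarith
  have htr' : ∀ x ∈ O, 0 < 2 + hessian u x 0 0 + hessian u x 1 1 := by
    intro x hx
    have := htr x hx
    rw [Matrix.trace_fin_two] at this
    linarith
  have hzero := eqOn_zero_of_fderiv_eq_mul (by simp) hO hOc (ζ := ζ) (W := W) ?_
    (fun x hx => (hWd x hx).differentiableAt) ?_ ?_ hx₀ ?_
  · intro x hx
    have h := hzero x hx
    have h1 := congrArg Complex.re h
    have h2 := congrArg Complex.im h
    simp only [hWdef, Complex.sub_re, Complex.sub_im, Complex.mul_re, Complex.mul_im,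
      Complex.ofReal_re, Complex.ofReal_im, Complex.I_re, Complex.I_im, Complex.zero_re,
      Complex.zero_im] at h1 h2
    refine Fin.forall_fin_two.mpr ⟨?_, ?_⟩
    · change p 0 x = x 0
      linarith
    · change p 1 x = x 1
      linarith
  · intro x hx
    have hc := fun i => (contDiff_coord i).contDiffAt (x := x) |>.of_le (m := 1) (by norm_num)
    exact (Complex.ofRealCLM.contDiff.contDiffAt.comp x ((hc 0).add (hpC x hx 0))).add
      ((Complex.ofRealCLM.contDiff.contDiffAt.comp x ((hc 1).add (hpC x hx 1))).mul
        contDiffAt_const)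
  · intro x hx y hy
    rw [hζy x hx] at hy
    have h1 := congrArg Complex.re hy
    have h2 := congrArg Complex.im hy
    simp only [Complex.zero_re, Complex.zero_im] at h1 h2
    have hd := hdet' x hx
    have ht := htr' x hx
    generalize hessian u x 0 0 = a at *
    generalize hessian u x 0 1 = b at *
    generalize hessian u x 1 1 = c at *
    -- Multiplication by the adjugate of `I + D²u`, whose determinant is `1 + tr + det = 2 + a + c`.
    have e0 : (2 + a + c) * y 0 = 0 := by
      linear_combination (1 + c) * h1 - b * h2 - y 0 * hd
    have e1 : (2 + a + c) * y 1 = 0 := by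
      linear_combination (1 + a) * h2 - b * h1 - y 1 * hd
    ext i
    fin_cases i
    · exact (mul_eq_zero.mp e0).resolve_left ht.ne'
    · exact (mul_eq_zero.mp e1).resolve_left ht.ne'
  · intro x hx
    have hd := hdet' x hx
    have ht := htr' x hx
    -- This is `DW(e₀) / Dζ(e₀)` simplified by `det D²u = 1`; the same relation makes it the correct
    -- multiplier for `e₁`.
    refine ⟨⟨(hessian u x 1 1 - hessian u x 0 0) / (2 + hessian u x 0 0 + hessian u x 1 1),
      2 * hessian u x 0 1 / (2 + hessian u x 0 0 + hessian u x 1 1)⟩, fun y => ?_⟩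
    rw [hζy x hx, hWy x hx]
    generalize hessian u x 0 0 = a at *
    generalize hessian u x 0 1 = b at *
    generalize hessian u x 1 1 = c at *
    apply Complex.ext
    · simp only [Complex.mul_re]
      field_simp
      linear_combination (-2 * y 0) * hd
    · simp only [Complex.mul_im]
      field_simp
      linear_combination (2 * y 1) * hd
  · filter_upwards [h0] with x hx
    have h1 : p 0 x = x 0 := hx 0
    have h2 : p 1 x = x 1 := hx 1
    simp [hWdef, h1, h2]

/-! ### Geometry of the cone -/

theorem euclidean_norm_sq (x : EuclideanSpace ℝ (Fin 2)) : ‖x‖ ^ 2 = x 0 ^ 2 + x 1 ^ 2 := by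
  rw [EuclideanSpace.norm_eq, Real.sq_sqrt (by positivity)]
  simp [Fin.sum_univ_two, sq_abs]

/-- A cone with opening angle between `π / 2` and `π` is an intersection of two half-planes. -/
theorem exists_cone_eq {μ : ℝ} (hμ : μ ∈ Ioo (1 / 2 : ℝ) 1) :
    ∃ m : ℝ, 0 < m ∧ cone μ = {x | 0 < x 1 ∧ 0 < x 0 + m * x 1} := by
  obtain ⟨h1, h2⟩ := hμ
  have hπ := Real.pi_pos
  have hs : 0 < Real.sin (μ * Real.pi) := Real.sin_pos_of_pos_of_lt_pi (by positivity) (by nlinarith)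
  have hc : Real.cos (μ * Real.pi) < 0 :=
    Real.cos_neg_of_pi_div_two_lt_of_lt (by nlinarith) (by nlinarith)
  -- `m = -cot(μπ)`, positive because the angle is obtuse.
  refine ⟨-Real.cos (μ * Real.pi) / Real.sin (μ * Real.pi), div_pos (by linarith) hs, ?_⟩
  have key : ∀ r θ : ℝ, r * Real.cos θ + -Real.cos (μ * Real.pi) / Real.sin (μ * Real.pi) *
      (r * Real.sin θ) = r * Real.sin (μ * Real.pi - θ) / Real.sin (μ * Real.pi) := by
    intro r θ
    rw [Real.sin_sub]
    field_simp
    ring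
  ext x
  constructor
  · rintro ⟨r, θ, hr, hθ0, hθ1, rfl⟩
    simp only [mem_ofPred_eq, Matrix.cons_val_zero, Matrix.cons_val_one]
    refine ⟨mul_pos hr (Real.sin_pos_of_pos_of_lt_pi hθ0 (by nlinarith)), ?_⟩
    rw [key]
    exact div_pos (mul_pos hr (Real.sin_pos_of_pos_of_lt_pi (by linarith) (by nlinarith))) hs
  · rintro ⟨hx1, hx2⟩
    set z : ℂ := ⟨x 0, x 1⟩ with hz
    have hz0 : z ≠ 0 := fun h => hx1.ne' (congrArg Complex.im h)
    have hr : 0 < ‖z‖ := norm_pos_iff.mpr hz0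
    have e0 : ‖z‖ * Real.cos z.arg = x 0 := Complex.norm_mul_cos_arg z
    have e1 : ‖z‖ * Real.sin z.arg = x 1 := Complex.norm_mul_sin_arg z
    have harg0 : 0 < z.arg := by
      refine lt_of_le_of_ne (Complex.arg_nonneg_iff.mpr hx1.le) fun h => ?_
      rw [← h, Real.sin_zero, mul_zero] at e1
      exact hx1.ne e1
    refine ⟨‖z‖, z.arg, hr, harg0, ?_, ?_⟩
    · rw [← e0, ← e1, key] at hx2
      by_contra! hcon
      have : Real.sin (μ * Real.pi - z.arg) ≤ 0 :=
        Real.sin_nonpos_of_nonpos_of_neg_pi_le (by linarith) (by nlinarith [Complex.arg_le_pi z])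
      have : ‖z‖ * Real.sin (μ * Real.pi - z.arg) / Real.sin (μ * Real.pi) ≤ 0 :=
        div_nonpos_of_nonpos_of_nonneg (mul_nonpos_of_nonneg_of_nonpos hr.le this) hs.le
      linarith
    · rw [e0, e1]
      ext i
      fin_cases i <;> rfl

/-- The open sector `{x₁ > 0, x₀ + m x₁ > 0}`. -/
def sector (m : ℝ) : Set (EuclideanSpace ℝ (Fin 2)) := {x | 0 < x 1 ∧ 0 < x 0 + m * x 1}

theorem isOpen_sector (m : ℝ) : IsOpen (sector m) := by
  have h0 : Continuous fun x : EuclideanSpace ℝ (Fin 2) => x 0 := by fun_prop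
  have h1 : Continuous fun x : EuclideanSpace ℝ (Fin 2) => x 1 := by fun_prop
  exact (isOpen_lt continuous_const h1).inter
    (isOpen_lt continuous_const (h0.add (continuous_const.mul h1)))

theorem convex_sector (m : ℝ) : Convex ℝ (sector m) := by
  rw [convex_iff_forall_pos]
  rintro x ⟨hx1, hx2⟩ y ⟨hy1, hy2⟩ a b ha hb -
  refine ⟨?_, ?_⟩
  · simp only [PiLp.add_apply, PiLp.smul_apply, smul_eq_mul]
    positivity
  · simp only [PiLp.add_apply, PiLp.smul_apply, smul_eq_mul]
    have h1 := mul_pos ha hx2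
    have h2 := mul_pos hb hy2
    linarith

/-- Points of the closed sector inside an open set are limits of points of the open sector. -/
theorem mem_closure_sector_inter {m : ℝ} (hm : 0 < m) {B : Set (EuclideanSpace ℝ (Fin 2))}
    (hB : IsOpen B) {x : EuclideanSpace ℝ (Fin 2)} (hxB : x ∈ B) (hx1 : 0 ≤ x 1)
    (hx2 : 0 ≤ x 0 + m * x 1) : x ∈ closure (sector m ∩ B) := by
  -- Moving in the direction `e₁` strictly increases both defining linear forms, since `m > 0`.
  have ht : Tendsto (fun t : ℝ => x + t • EuclideanSpace.single (1 : Fin 2) (1 : ℝ)) (𝓝[>] 0)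
      (𝓝 x) := by
    have hc : Continuous fun t : ℝ => x + t • EuclideanSpace.single (1 : Fin 2) (1 : ℝ) := by
      fun_prop
    have := hc.tendsto 0
    simp only [zero_smul, add_zero] at this
    exact this.mono_left nhdsWithin_le_nhds
  refine mem_closure_of_tendsto ht ?_
  filter_upwards [ht (hB.mem_nhds hxB), self_mem_nhdsWithin] with t h1 h2
  have h2' : 0 < t := h2
  refine ⟨⟨?_, ?_⟩, h1⟩
  · simp
    linarith
  · simp
    have := mul_pos hm h2'
    linarith

theorem mem_frontier_sector {m : ℝ} (hm : 0 < m) {x : EuclideanSpace ℝ (Fin 2)} (hx1 : 0 ≤ x 1)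
    (hx2 : 0 ≤ x 0 + m * x 1) (hx : x 1 = 0 ∨ x 0 + m * x 1 = 0) : x ∈ frontier (sector m) := by
  rw [frontier, (isOpen_sector m).interior_eq]
  refine ⟨?_, ?_⟩
  · simpa using mem_closure_sector_inter hm isOpen_univ (mem_univ x) hx1 hx2
  · rintro ⟨h1, h2⟩
    rcases hx with h | h <;> linarith

/-! ### Order of vanishing at the vertex -/

/-- A within-derivative vanishes in any direction along which the function is zero. -/
theorem HasFDerivWithinAt.apply_eq_zero_of_segment {E : Type*} [NormedAddCommGroup E]
    [NormedSpace ℝ E] {f : E → ℝ} {L : E →L[ℝ] ℝ} {C : Set E} (hf : HasFDerivWithinAt f L C 0)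
    {d : E} {τ : ℝ} (hτ : 0 < τ) (hC : ∀ t ∈ Icc 0 τ, t • d ∈ C)
    (h0 : ∀ t ∈ Icc 0 τ, f (t • d) = 0) : L d = 0 := by
  have hline : HasDerivWithinAt (fun t : ℝ => t • d) d (Icc 0 τ) 0 := by
    simpa using ((hasDerivAt_id (0 : ℝ)).smul_const d).hasDerivWithinAt
  have hf' : HasFDerivWithinAt f L C ((0 : ℝ) • d) := by rwa [zero_smul]
  have h1 : HasDerivWithinAt (f ∘ fun t : ℝ => t • d) (L d) (Icc 0 τ) 0 :=
    hf'.comp_hasDerivWithinAt 0 hline hC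
  have hmem : (0 : ℝ) ∈ Icc 0 τ := ⟨le_rfl, hτ.le⟩
  have h2 : HasDerivWithinAt (f ∘ fun t : ℝ => t • d) 0 (Icc 0 τ) 0 :=
    (hasDerivWithinAt_const (0 : ℝ) (Icc 0 τ) (0 : ℝ)).congr h0 (h0 0 hmem)
  exact (uniqueDiffOn_Icc hτ 0 hmem).eq_deriv _ h1 h2

/-- A `C²` function on a convex set whose `2`-jet vanishes at `0` is `o(‖x‖²)`. -/
theorem norm_le_mul_norm_sq_of_jet_eq_zero {E : Type*} [NormedAddCommGroup E] [NormedSpace ℝ E]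
    {f : E → ℝ} {C : Set E} (hC : Convex ℝ C) (hCu : UniqueDiffOn ℝ C) (h0C : (0 : E) ∈ C)
    (hf : ContDiffOn ℝ 2 f C) (h0 : f 0 = 0) (h1 : fderivWithin ℝ f C 0 = 0)
    (h2 : fderivWithin ℝ (fderivWithin ℝ f C) C 0 = 0) {ε : ℝ} (hε : 0 < ε) :
    ∃ ρ > 0, ∀ x ∈ C, ‖x‖ < ρ → |f x| ≤ ε * ‖x‖ ^ 2 := by
  have hF : HasFDerivWithinAt (fderivWithin ℝ f C) (0 : E →L[ℝ] E →L[ℝ] ℝ) C 0 := by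
    rw [← h2]
    exact ((hf.fderivWithin hCu (m := 1) (by norm_num)).differentiableOn (by simp) 0
      h0C).hasFDerivWithinAt
  have hlo := hF.isLittleO.def hε
  obtain ⟨ρ, hρ, hb⟩ := Metric.mem_nhdsWithin_iff.mp hlo
  refine ⟨ρ, hρ, fun x hx hxρ => ?_⟩
  -- The gradient is `o(‖y‖)` at the origin; the mean value inequality on the convex set `C ∩
  -- closedBall 0 ‖x‖` supplies the second factor `‖x‖`.
  have hbound : ∀ y ∈ C ∩ Metric.closedBall 0 ‖x‖, ‖fderivWithin ℝ f C y‖ ≤ ε * ‖x‖ := by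
    rintro y ⟨hyC, hyx⟩
    have hyx' : ‖y‖ ≤ ‖x‖ := by simpa using hyx
    have := hb ⟨by simpa using hyx'.trans_lt hxρ, hyC⟩
    simp only [mem_ofPred_eq, h1, sub_zero, zero_apply] at this
    exact this.trans (by gcongr)
  have := (hC.inter (convex_closedBall 0 ‖x‖)).norm_image_sub_le_of_norm_hasFDerivWithin_le
    (fun y hy => ((hf.differentiableOn (by simp) y hy.1).hasFDerivWithinAt.mono inter_subset_left))
    hbound ⟨h0C, by simp⟩ ⟨hx, by simp⟩
  rw [h0, sub_zero, sub_zero, Real.norm_eq_abs] at this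
  linarith

/-- A negative function with nonnegative Laplacian on an obtuse sector which vanishes at the
vertex cannot be `o(‖x‖²)` there. -/
theorem exists_eq_zero_of_isLittleO_sq {m δ : ℝ} (hm : 0 < m) (hδ : 0 < δ)
    {f : EuclideanSpace ℝ (Fin 2) → ℝ}
    (hfc : ContinuousOn f (closure (sector m ∩ Metric.ball 0 δ)))
    (hf : ∀ x ∈ sector m ∩ Metric.ball 0 δ, ContDiffAt ℝ 2 f x)
    (hΔ : ∀ x ∈ sector m ∩ Metric.ball 0 δ, 0 ≤ (hessian f x).trace)
    (hle : ∀ x ∈ sector m ∩ Metric.ball 0 δ, f x ≤ 0) (h0 : f 0 = 0)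
    (ho : ∀ ε > 0, ∃ ρ > 0, ∀ x ∈ sector m ∩ Metric.ball 0 δ, ‖x‖ < ρ → |f x| ≤ ε * ‖x‖ ^ 2) :
    ∃ x ∈ sector m ∩ Metric.ball 0 δ, f x = 0 := by
  by_contra! hne
  have hneg : ∀ x ∈ sector m ∩ Metric.ball 0 δ, f x < 0 := fun x hx =>
    lt_of_le_of_ne (hle x hx) (hne x hx)
  -- `A` and `B` are orthogonal coordinates, rotated and scaled. The edges of the quadrant `A, B ≥
  -- 0` have directions `(1, ε)` and `(-ε, 1)`, both in the open sector because `0 < ε < m`.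
  set ε := m / 2 with hε
  have hε0 : 0 < ε := by positivity
  set A : EuclideanSpace ℝ (Fin 2) → ℝ := fun x => 1 * x 0 + ε * x 1 with hA
  set B : EuclideanSpace ℝ (Fin 2) → ℝ := fun x => -ε * x 0 + 1 * x 1 with hB
  have hAC : ContDiff ℝ 2 A := by
    have h0 := contDiff_coord 0
    have h1 := contDiff_coord 1
    fun_prop
  have hBC : ContDiff ℝ 2 B := by
    have h0 := contDiff_coord 0
    have h1 := contDiff_coord 1
    fun_prop
  set τ := δ / 2 with hτ
  have hτ0 : 0 < τ := by positivity
  set K : Set (EuclideanSpace ℝ (Fin 2)) := {x | (0 ≤ A x ∧ A x ≤ τ) ∧ 0 ≤ B x ∧ B x ≤ τ} with hK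
  set U : Set (EuclideanSpace ℝ (Fin 2)) := {x | (0 < A x ∧ A x < τ) ∧ 0 < B x ∧ B x < τ} with hU
  have hnorm : ∀ x, (1 + ε ^ 2) * ‖x‖ ^ 2 = A x ^ 2 + B x ^ 2 := by
    intro x
    rw [euclidean_norm_sq]
    simp only [hA, hB]
    ring
  have hKball : K ⊆ Metric.ball 0 δ := by
    rintro x ⟨⟨h1, h2⟩, h3, h4⟩
    rw [mem_ball_zero_iff]
    have h5 := hnorm x
    have h6 : A x ^ 2 ≤ τ ^ 2 := by gcongr
    have h7 : B x ^ 2 ≤ τ ^ 2 := by gcongr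
    have h8 : ‖x‖ ^ 2 < δ ^ 2 := by
      have : 0 ≤ ε ^ 2 * ‖x‖ ^ 2 := by positivity
      have : 0 < δ ^ 2 := by positivity
      rw [hτ] at h6 h7
      nlinarith
    exact lt_of_pow_lt_pow_left₀ 2 hδ.le h8
  have hsec : ∀ x, 0 ≤ A x → 0 ≤ B x → 0 < A x + B x → x ∈ sector m := by
    intro x h1 h2 h3
    have e1 : (1 + ε ^ 2) * x 1 = ε * A x + B x := by simp only [hA, hB]; ring
    have e2 : (1 + ε ^ 2) * (x 0 + m * x 1) = (1 + 2 * ε ^ 2) * A x + ε * B x := by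
      have : m = 2 * ε := by rw [hε]; ring
      simp only [hA, hB, this]
      ring
    have hcomb : ∀ p q : ℝ, 0 < p → 0 < q → 0 < p * A x + q * B x := by
      intro p q hp hq
      rcases h1.eq_or_lt with h | h
      · rw [← h] at h3 ⊢
        nlinarith
      · have := mul_pos hp h
        have := mul_nonneg hq.le h2
        linarith
    refine ⟨pos_of_mul_pos_right (a := 1 + ε ^ 2) ?_ (by positivity),
      pos_of_mul_pos_right (a := 1 + ε ^ 2) ?_ (by positivity)⟩
    · rw [e1]
      simpa using hcomb ε 1 hε0 one_pos
    · rw [e2]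
      exact hcomb _ _ (by positivity) hε0
  have hzero : ∀ x, A x = 0 → B x = 0 → x = 0 := by
    intro x h1 h2
    have h3 := hnorm x
    rw [h1, h2] at h3
    have h4 : ‖x‖ ^ 2 = 0 := by
      have : (1 + ε ^ 2) ≠ 0 := by positivity
      have h5 : (1 + ε ^ 2) * ‖x‖ ^ 2 = 0 := by rw [h3]; ring
      exact (mul_eq_zero.mp h5).resolve_left this
    exact norm_eq_zero.mp (pow_eq_zero_iff (by norm_num) |>.mp h4)
  have hKsec : ∀ x ∈ K, 0 < A x + B x → x ∈ sector m ∩ Metric.ball 0 δ := fun x hx hp =>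
    ⟨hsec x hx.1.1 hx.2.1 hp, hKball hx⟩
  have hKle : ∀ x ∈ K, f x ≤ 0 := by
    intro x hx
    rcases (add_nonneg hx.1.1 hx.2.1).eq_or_lt with h | h
    · have h1 : A x = 0 := by linarith [hx.1.1, hx.2.1]
      have h2 : B x = 0 := by linarith [hx.1.1, hx.2.1]
      rw [hzero x h1 h2, h0]
    · exact hle x (hKsec x hx h)
  have hKcl : IsClosed K :=
    ((isClosed_le continuous_const hAC.continuous).inter
      (isClosed_le hAC.continuous continuous_const)).inter
    ((isClosed_le continuous_const hBC.continuous).inter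
      (isClosed_le hBC.continuous continuous_const))
  have hKc : IsCompact K :=
    (isCompact_closedBall 0 δ).of_isClosed_subset hKcl
      (hKball.trans Metric.ball_subset_closedBall)
  have hUo : IsOpen U :=
    ((isOpen_lt continuous_const hAC.continuous).inter
      (isOpen_lt hAC.continuous continuous_const)).inter
    ((isOpen_lt continuous_const hBC.continuous).inter
      (isOpen_lt hBC.continuous continuous_const))
  have hUK : U ⊆ K := fun x hx => ⟨⟨hx.1.1.le, hx.1.2.le⟩, hx.2.1.le, hx.2.2.le⟩
  have hUsec : ∀ x ∈ U, x ∈ sector m ∩ Metric.ball 0 δ := fun x hx =>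
    hKsec x (hUK hx) (add_pos hx.1.1 hx.2.1)
  have hKclos : K ⊆ closure (sector m ∩ Metric.ball 0 δ) := by
    intro x hx
    rcases (add_nonneg hx.1.1 hx.2.1).eq_or_lt with h | h
    · have h1 : A x = 0 := by linarith [hx.1.1, hx.2.1]
      have h2 : B x = 0 := by linarith [hx.1.1, hx.2.1]
      rw [hzero x h1 h2]
      exact mem_closure_sector_inter hm Metric.isOpen_ball (Metric.mem_ball_self hδ) (by simp)
        (by simp)
    · exact subset_closure (hKsec x hx h)
  have hdiag : ∀ t : ℝ, A !₂[t * (1 - ε), t * (1 + ε)] = t * (1 + ε ^ 2) ∧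
      B !₂[t * (1 - ε), t * (1 + ε)] = t * (1 + ε ^ 2) := by
    intro t
    simp only [hA, hB, Matrix.cons_val_zero, Matrix.cons_val_one]
    constructor <;> ring
  -- The two sides of the square away from the vertex form a compact subset of the open sector, so
  -- `f` has a negative maximum there.
  set E : Set (EuclideanSpace ℝ (Fin 2)) := K ∩ ({x | A x = τ} ∪ {x | B x = τ}) with hE
  have hEc : IsCompact E := hKc.inter_right
    ((isClosed_eq hAC.continuous continuous_const).union
      (isClosed_eq hBC.continuous continuous_const))
  have hEne : E.Nonempty := by
    obtain ⟨h1, h2⟩ := hdiag (τ / (1 + ε ^ 2))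
    rw [div_mul_cancel₀ _ (by positivity)] at h1 h2
    refine ⟨_, ⟨⟨?_, ?_⟩, ?_, ?_⟩, Or.inl h1⟩ <;> linarith
  obtain ⟨z, hzE, hzmax⟩ := hEc.exists_isMaxOn hEne (hfc.mono (inter_subset_left.trans hKclos))
  have hEpos : ∀ x ∈ E, 0 < A x + B x := by
    rintro x ⟨hx, h | h⟩
    · have h' : A x = τ := h
      linarith [hx.2.1]
    · have h' : B x = τ := h
      linarith [hx.1.1]
  have hfz : f z < 0 := hneg z (hKsec z hzE.1 (hEpos z hzE))
  set c := -f z / τ ^ 2 with hc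
  have hc0 : 0 < c := div_pos (by linarith) (by positivity)
  have hcτ : c * τ ^ 2 = -f z := by rw [hc]; field_simp
  have hABt : ∀ x, (hessian (fun y => A y * B y) x).trace = 0 := by
    intro x
    have := trace_hessian_linear_mul_linear !₂[1, ε] !₂[-ε, 1] x
    simp only [Matrix.cons_val_zero, Matrix.cons_val_one] at this
    rw [this]
    ring
  have hABC : ContDiff ℝ 2 fun y => A y * B y := hAC.mul hBC
  -- On the sides through the vertex `A B = 0` and `f ≤ 0`; on `E`, `c A B ≤ c τ² = -f z`.
  have hmain := nonpos_of_trace_hessian_nonneg (f := fun y => f y + c * (A y * B y)) hKc hUo hUK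
    ((hfc.mono hKclos).add (contDiff_const.mul hABC).continuous.continuousOn)
    (fun x hx => (hf x (hUsec x hx)).add (contDiff_const.mul hABC).contDiffAt)
    (fun x hx => by
      rw [hessian_add (hf x (hUsec x hx)) (contDiff_const.mul hABC).contDiffAt,
        hessian_const_mul hABC.contDiffAt, Matrix.trace_add, Matrix.trace_smul, hABt, smul_zero,
        add_zero]
      exact hΔ x (hUsec x hx)) (by
      intro x hx hxU
      have hfx := hKle x hx
      by_cases hAB : A x * B x = 0
      · simpa [hAB] using hfx
      have hA0 : 0 < A x := lt_of_le_of_ne hx.1.1 fun h => hAB (by rw [← h, zero_mul])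
      have hB0 : 0 < B x := lt_of_le_of_ne hx.2.1 fun h => hAB (by rw [← h, mul_zero])
      have hxE : x ∈ E := by
        refine ⟨hx, ?_⟩
        by_contra hn
        refine hxU ⟨⟨hA0, lt_of_le_of_ne hx.1.2 fun h => hn (Or.inl h)⟩, hB0,
          lt_of_le_of_ne hx.2.2 fun h => hn (Or.inr h)⟩
      have h1 : f x ≤ f z := hzmax hxE
      have h2 : A x * B x ≤ τ ^ 2 := by
        rw [sq]
        exact mul_le_mul hx.1.2 hx.2.2 hB0.le hτ0.le
      have h3 := mul_le_mul_of_nonneg_left h2 hc0.le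
      linarith)
  have hk : 0 < 1 + ε ^ 2 := by positivity
  -- On the diagonal `A B = t²(1 + ε²)²` and `‖x‖² = 2t²(1 + ε²)`, so this constant bounds `|f|` by
  -- `c A B / 2`, against `f ≤ -c A B`.
  obtain ⟨ρ, hρ, hsmall⟩ := ho (c * (1 + ε ^ 2) / 4) (by positivity)
  set t := min (τ / (1 + ε ^ 2)) (ρ / (2 * (1 + ε ^ 2))) with ht
  have ht0 : 0 < t := by positivity
  obtain ⟨hA1, hB1⟩ := hdiag t
  set x : EuclideanSpace ℝ (Fin 2) := !₂[t * (1 - ε), t * (1 + ε)]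
  have htk : 0 < t * (1 + ε ^ 2) := by positivity
  have htτ : t * (1 + ε ^ 2) ≤ τ := by
    rw [← le_div_iff₀ hk]
    exact min_le_left _ _
  have htρ : t * (2 * (1 + ε ^ 2)) ≤ ρ := by
    rw [← le_div_iff₀ (by positivity)]
    exact min_le_right _ _
  have hxK : x ∈ K := ⟨⟨by rw [hA1]; exact htk.le, by rwa [hA1]⟩, by rw [hB1]; exact htk.le,
    by rwa [hB1]⟩
  have hxsec := hKsec x hxK (by rw [hA1, hB1]; linarith)
  have hnx : ‖x‖ ^ 2 = 2 * t ^ 2 * (1 + ε ^ 2) := by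
    have h1 := hnorm x
    rw [hA1, hB1] at h1
    refine mul_left_cancel₀ hk.ne' ?_
    rw [h1]
    ring
  have hxρ : ‖x‖ < ρ := by
    refine lt_of_pow_lt_pow_left₀ 2 hρ.le ?_
    have h1 : (t * (2 * (1 + ε ^ 2))) ^ 2 ≤ ρ ^ 2 := by gcongr
    have h2 : (t * (2 * (1 + ε ^ 2))) ^ 2 = 2 * t ^ 2 * (1 + ε ^ 2) * (2 * (1 + ε ^ 2)) := by ring
    have h3 : 0 < 2 * t ^ 2 * (1 + ε ^ 2) := by positivity
    rw [hnx]
    nlinarith [sq_nonneg ε]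
  have h1 := hsmall x hxsec hxρ
  have h2 := hmain x hxK
  simp only [hA1, hB1] at h2
  rw [hnx] at h1
  have h3 := (abs_le.mp h1).1
  have h4 : 0 < c * (t * (1 + ε ^ 2) * (t * (1 + ε ^ 2))) := by positivity
  nlinarith

/-! ### Traces and one-sided Hessians -/

theorem hessian_sub_half_norm_sq_trace {u : EuclideanSpace ℝ (Fin 2) → ℝ}
    {x : EuclideanSpace ℝ (Fin 2)} (hu : ContDiffAt ℝ 2 u x) :
    (hessian (fun y => u y - ‖y‖ ^ 2 / 2) x).trace = (hessian u x).trace - 2 := by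
  have h0 := contDiff_coord 0
  have h1 := contDiff_coord 1
  have hfun : (fun y => u y - ‖y‖ ^ 2 / 2) = fun y => u y + -(1 / 2) *
      ((1 * y 0 + 0 * y 1) * (1 * y 0 + 0 * y 1) +
        (0 * y 0 + 1 * y 1) * (0 * y 0 + 1 * y 1)) := by
    funext y
    rw [euclidean_norm_sq]
    ring
  have t0 := trace_hessian_linear_mul_linear !₂[1, 0] !₂[1, 0] x
  have t1 := trace_hessian_linear_mul_linear !₂[0, 1] !₂[0, 1] x
  simp only [Matrix.cons_val_zero, Matrix.cons_val_one] at t0 t1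
  rw [hfun, hessian_add hu (by fun_prop), hessian_const_mul (by fun_prop),
    hessian_add (by fun_prop) (by fun_prop), Matrix.trace_add, Matrix.trace_smul,
    Matrix.trace_add, t0, t1]
  norm_num
  ring

/-- A symmetric `2 × 2` matrix of determinant one has trace at least `2` in absolute value. -/
theorem four_le_trace_sq {M : Matrix (Fin 2) (Fin 2) ℝ} (hM : M.det = 1)
    (hs : M 1 0 = M 0 1) : 4 ≤ M.trace ^ 2 := by
  rw [Matrix.det_fin_two, hs] at hM
  rw [Matrix.trace_fin_two]
  nlinarith [sq_nonneg (M 0 0 - M 1 1), sq_nonneg (M 0 1)]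

theorem hessian_symm {u : EuclideanSpace ℝ (Fin 2) → ℝ} {x : EuclideanSpace ℝ (Fin 2)}
    (hu : ContDiffAt ℝ 2 u x) : hessian u x 1 0 = hessian u x 0 1 := by
  simp only [hessian, Matrix.of_apply, iteratedFDeriv_two_apply]
  exact (hu.isSymmSndFDerivAt (by simp)) _ _

/-- Carries the value of the Hessian at the vertex, a boundary point, to nearby interior points. -/
theorem continuousOn_trace_hessianWithin {f : EuclideanSpace ℝ (Fin 2) → ℝ}
    {C : Set (EuclideanSpace ℝ (Fin 2))} (hC : UniqueDiffOn ℝ C) (hf : ContDiffOn ℝ 2 f C) :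
    ContinuousOn (fun x => (hessianWithin f C x).trace) C := by
  have h := hf.continuousOn_iteratedFDerivWithin (m := 2) (by norm_num) hC
  have hi : ∀ m : Fin 2 → EuclideanSpace ℝ (Fin 2),
      ContinuousOn (fun x => iteratedFDerivWithin ℝ 2 f C x m) C := fun m =>
    (ContinuousMultilinearMap.apply ℝ (fun _ : Fin 2 => EuclideanSpace ℝ (Fin 2)) ℝ
      m).continuous.comp_continuousOn h
  simp only [Matrix.trace_fin_two, hessianWithin, Matrix.of_apply]
  exact (hi _).add (hi _)

theorem hessianWithin_eq_hessian {f : EuclideanSpace ℝ (Fin 2) → ℝ}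
    {C : Set (EuclideanSpace ℝ (Fin 2))} (hC : UniqueDiffOn ℝ C) {x : EuclideanSpace ℝ (Fin 2)}
    (hx : x ∈ C) (hf : ContDiffAt ℝ 2 f x) : hessianWithin f C x = hessian f x := by
  ext i j
  simp only [hessianWithin, hessian, Matrix.of_apply]
  rw [iteratedFDerivWithin_eq_iteratedFDeriv hC (by exact_mod_cast hf) hx]

theorem fderivWithin_fderivWithin_eq_zero_of_hessianWithin {f : EuclideanSpace ℝ (Fin 2) → ℝ}
    {C : Set (EuclideanSpace ℝ (Fin 2))} (hC : UniqueDiffOn ℝ C) {x : EuclideanSpace ℝ (Fin 2)}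
    (hx : x ∈ C) (h : hessianWithin f C x = 0) :
    fderivWithin ℝ (fderivWithin ℝ f C) C x = 0 := by
  have hij : ∀ i j : Fin 2, fderivWithin ℝ (fderivWithin ℝ f C) C x (EuclideanSpace.single i 1)
      (EuclideanSpace.single j 1) = 0 := by
    intro i j
    have := congrFun (congrFun h i) j
    simpa [hessianWithin, iteratedFDerivWithin_two_apply f hC hx] using this
  ext y z
  rw [EuclideanSpace.map_fin_two _ y, EuclideanSpace.map_fin_two _ z]
  simp [hij]

/-! ### The rigidity theorem -/

theorem mainTheorem4 (μ : ℝ) (hμ : μ ∈ Set.Ioo (1 / 2 : ℝ) 1)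
    (u v : EuclideanSpace ℝ (Fin 2) → ℝ)
    (hv : ∀ x, v x = u x - ‖x‖ ^ 2 / 2)
    (hu : ContDiffOn ℝ 2 u (closure (truncCone μ)))
    (hdet : ∀ x ∈ truncCone μ, (hessian u x).det = 1)
    (hbdry : ∀ x ∈ frontier (cone μ) ∩ Metric.ball 0 1, u x = ‖x‖ ^ 2 / 2)
    (hv0 : hessianWithin v (closure (truncCone μ)) 0 = 0)
    (hneg : ∃ δ > 0, ∀ x ∈ cone μ ∩ Metric.ball 0 δ, v x ≤ 0) :
    ∀ x ∈ closure (truncCone μ), v x = 0 := by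
  obtain ⟨m, hm, hcone⟩ := exists_cone_eq hμ
  change cone μ = sector m at hcone
  obtain ⟨δ', hδ', hneg⟩ := hneg
  have hvf : v = fun x => u x - ‖x‖ ^ 2 / 2 := funext hv
  rw [truncCone, hcone] at hu hdet hv0 ⊢
  rw [hcone] at hbdry hneg
  set O := sector m ∩ Metric.ball (0 : EuclideanSpace ℝ (Fin 2)) 1 with hOdef
  set C := closure O with hCdef
  have hOo : IsOpen O := (isOpen_sector m).inter Metric.isOpen_ball
  have hOconv : Convex ℝ O := (convex_sector m).inter (convex_ball 0 1)
  have hOC : O ⊆ C := subset_closure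
  have hclosed : ∀ x, 0 ≤ x 1 → 0 ≤ x 0 + m * x 1 → ‖x‖ < 1 → x ∈ C := fun x h1 h2 h3 =>
    mem_closure_sector_inter hm Metric.isOpen_ball (by simpa using h3) h1 h2
  have h0C : (0 : EuclideanSpace ℝ (Fin 2)) ∈ C := hclosed 0 (by simp) (by simp) (by simp)
  have hOne : O.Nonempty := closure_nonempty_iff.mp ⟨0, h0C⟩
  have hCconv : Convex ℝ C := hOconv.closure
  have hCu : UniqueDiffOn ℝ C := uniqueDiffOn_convex hCconv
    (hOne.mono (interior_maximal hOC hOo))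
  have hnhds : ∀ x ∈ O, C ∈ 𝓝 x := fun x hx => mem_of_superset (hOo.mem_nhds hx) hOC
  have hvC : ContDiffOn ℝ 2 v C := by
    rw [hvf]
    exact hu.sub ((contDiff_norm_sq ℝ).div_const 2).contDiffOn
  have huA : ∀ x ∈ O, ContDiffAt ℝ 2 u x := fun x hx => (hu x (hOC hx)).contDiffAt (hnhds x hx)
  have hvA : ∀ x ∈ O, ContDiffAt ℝ 2 v x := fun x hx => (hvC x (hOC hx)).contDiffAt (hnhds x hx)
  have htrv : ∀ x ∈ O, (hessian v x).trace = (hessian u x).trace - 2 := fun x hx => by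
    rw [hvf]
    exact hessian_sub_half_norm_sq_trace (huA x hx)
  -- The trace of the Hessian of `u` is at least `2`.
  have hsq : ∀ x ∈ O, 4 ≤ (hessian u x).trace ^ 2 := fun x hx =>
    four_le_trace_sq (hdet x hx) (hessian_symm (huA x hx))
  have htrc : ContinuousOn (fun x => (hessianWithin v C x).trace) C :=
    continuousOn_trace_hessianWithin hCu hvC
  have htrO : ∀ x ∈ O, (hessian u x).trace = (hessianWithin v C x).trace + 2 := fun x hx => by
    rw [hessianWithin_eq_hessian hCu (hOC hx) (hvA x hx), htrv x hx]
    ring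
  have hucont : ContinuousOn (fun x => (hessian u x).trace) O :=
    ((htrc.mono hOC).add continuousOn_const).congr htrO
  -- The trace avoids `(-2, 2)`; it is positive somewhere near the vertex, so a nonpositive value
  -- would force a zero by the intermediate value theorem.
  have htr : ∀ x ∈ O, 2 ≤ (hessian u x).trace := by
    obtain ⟨y, hyO, hy⟩ : ∃ y ∈ O, 0 < (hessian u y).trace := by
      have h1 : ∀ᶠ x in 𝓝[C] 0, -2 < (hessianWithin v C x).trace :=
        (htrc 0 h0C).eventually (lt_mem_nhds (by simp [hv0]))
      have h2 : ∀ᶠ x in 𝓝[O] 0, -2 < (hessianWithin v C x).trace :=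
        h1.filter_mono (nhdsWithin_mono 0 hOC)
      have : (𝓝[O] (0 : EuclideanSpace ℝ (Fin 2))).NeBot := mem_closure_iff_nhdsWithin_neBot.mp h0C
      obtain ⟨y, hy1, hy2⟩ := (h2.and self_mem_nhdsWithin).exists
      exact ⟨y, hy2, by rw [htrO y hy2]; linarith⟩
    intro x hx
    by_contra! hlt
    have hx0 : (hessian u x).trace ≤ 0 := by
      by_contra! h
      nlinarith [hsq x hx]
    obtain ⟨z, hz, hz0⟩ := hOconv.isPreconnected.intermediate_value hx hyO hucont ⟨hx0, hy.le⟩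
    have := hsq z hz
    simp only at hz0
    rw [hz0] at this
    norm_num at this
  -- The `2`-jet of `v` at the vertex vanishes.
  have hvray : ∀ x, 0 ≤ x 1 → 0 ≤ x 0 + m * x 1 → (x 1 = 0 ∨ x 0 + m * x 1 = 0) → ‖x‖ < 1 →
      v x = 0 := by
    intro x h1 h2 h3 h4
    rw [hv, hbdry x ⟨mem_frontier_sector hm h1 h2 h3, by simpa using h4⟩, sub_self]
  have hv00 : v 0 = 0 := hvray 0 (by simp) (by simp) (by simp) (by simp)
  have hD : HasFDerivWithinAt v (fderivWithin ℝ v C 0) C 0 :=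
    (hvC.differentiableOn (by simp) 0 h0C).hasFDerivWithinAt
  have hdir : ∀ d : EuclideanSpace ℝ (Fin 2), 0 ≤ d 1 → 0 ≤ d 0 + m * d 1 →
      (d 1 = 0 ∨ d 0 + m * d 1 = 0) → fderivWithin ℝ v C 0 d = 0 := by
    intro d h1 h2 h3
    have hn : 0 < ‖d‖ + 1 := by positivity
    have hfac : ∀ t : ℝ, t * d 0 + m * (t * d 1) = t * (d 0 + m * d 1) := fun t => by ring
    have hsmall : ∀ t ∈ Icc (0 : ℝ) (‖d‖ + 1)⁻¹, 0 ≤ (t • d) 1 ∧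
        0 ≤ (t • d) 0 + m * (t • d) 1 ∧ ((t • d) 1 = 0 ∨ (t • d) 0 + m * (t • d) 1 = 0) ∧
          ‖t • d‖ < 1 := by
      rintro t ⟨ht0, ht1⟩
      simp only [PiLp.smul_apply, smul_eq_mul, hfac]
      refine ⟨mul_nonneg ht0 h1, mul_nonneg ht0 h2, ?_, ?_⟩
      · rcases h3 with h | h <;> simp [h]
      · rw [norm_smul, Real.norm_of_nonneg ht0]
        calc t * ‖d‖ ≤ (‖d‖ + 1)⁻¹ * ‖d‖ := by gcongr
          _ < 1 := by
            rw [inv_mul_eq_div, div_lt_one hn]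
            linarith
    exact hD.apply_eq_zero_of_segment (inv_pos.mpr hn)
      (fun t ht => by
        obtain ⟨a, b, -, c⟩ := hsmall t ht
        exact hclosed _ a b c)
      (fun t ht => by
        obtain ⟨a, b, c, d⟩ := hsmall t ht
        exact hvray _ a b c d)
  have hD0 : fderivWithin ℝ v C 0 = 0 := by
    have e0 := hdir (EuclideanSpace.single 0 1) (by simp) (by simp) (by simp)
    -- `(-m, 1)` spans the second edge, independent of `e₀`.
    have e1 := hdir !₂[-m, 1] (by simp) (by simp) (by simp)
    rw [EuclideanSpace.map_fin_two] at e1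
    have e2 : fderivWithin ℝ v C 0 (EuclideanSpace.single 1 1) = 0 := by simpa [e0] using e1
    ext y
    rw [EuclideanSpace.map_fin_two, e0, e2]
    simp
  have hDD := fderivWithin_fderivWithin_eq_zero_of_hessianWithin hCu h0C hv0
  -- `v` vanishes at an interior point near the vertex, hence on a neighbourhood of it.
  set δ := min δ' 1 with hδdef
  have hδ : 0 < δ := lt_min hδ' one_pos
  have hsub : sector m ∩ Metric.ball 0 δ ⊆ O :=
    inter_subset_inter_right _ (Metric.ball_subset_ball (min_le_right _ _))
  have hvΔ : ∀ x ∈ O, 0 ≤ (hessian v x).trace := fun x hx => by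
    rw [htrv x hx]
    linarith [htr x hx]
  have hvle : ∀ x ∈ sector m ∩ Metric.ball 0 δ, v x ≤ 0 := fun x hx =>
    hneg x ⟨hx.1, Metric.ball_subset_ball (min_le_left _ _) hx.2⟩
  obtain ⟨x₀, hx₀, hvx₀⟩ := exists_eq_zero_of_isLittleO_sq hm hδ
    (hvC.continuousOn.mono (closure_mono hsub)) (fun x hx => hvA x (hsub hx))
    (fun x hx => hvΔ x (hsub hx)) hvle hv00 (fun ε hε => by
      obtain ⟨ρ, hρ, h⟩ := norm_le_mul_norm_sq_of_jet_eq_zero hCconv hCu h0C hvC hv00 hD0 hDD hε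
      exact ⟨ρ, hρ, fun x hx => h x (hOC (hsub hx))⟩)
  have hev : ∀ᶠ x in 𝓝 x₀, v x = 0 := by
    have hopen : IsOpen (sector m ∩ Metric.ball (0 : EuclideanSpace ℝ (Fin 2)) δ) :=
      (isOpen_sector m).inter Metric.isOpen_ball
    obtain ⟨R, hR, hball⟩ := Metric.isOpen_iff.mp hopen x₀ hx₀
    -- With `p` within `R/3` of `x₀`, the disc of radius `R/2` about `p` contains `x₀` and stays in
    -- the sector; `v p < 0` would then force `v x₀ < 0`.
    filter_upwards [Metric.ball_mem_nhds x₀ (show 0 < R / 3 by linarith)] with p hp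
    have hp' : dist p x₀ < R / 3 := hp
    have hsubp : Metric.closedBall p (R / 2) ⊆ sector m ∩ Metric.ball 0 δ :=
      (Metric.closedBall_subset_ball' (by linarith)).trans hball
    refine le_antisymm (hvle p (hsubp (Metric.mem_closedBall_self (by linarith)))) ?_
    by_contra! hlt
    have := neg_of_neg_center (fun x hx => hvA x (hsub (hsubp hx)))
      (fun x hx => hvΔ x (hsub (hsubp hx))) (fun x hx => hvle x (hsubp hx)) hlt x₀
      (by rw [Metric.mem_ball, dist_comm]; linarith)
    linarith
  -- Unique continuation.
  have hfd : ∀ x ∈ O, ∀ i, fderiv ℝ u x (EuclideanSpace.single i 1) =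
      fderiv ℝ v x (EuclideanSpace.single i 1) + x i := by
    intro x hx i
    have hn : HasFDerivAt (fun y : EuclideanSpace ℝ (Fin 2) => ‖y‖ ^ 2) (2 • innerSL ℝ x) x :=
      (hasStrictFDerivAt_norm_sq x).hasFDerivAt
    have h := ((hvA x hx).differentiableAt (by simp)).hasFDerivAt.add (hn.mul_const (1 / 2))
    have hfun : (v + fun y : EuclideanSpace ℝ (Fin 2) => ‖y‖ ^ 2 * (1 / 2)) = u := by
      funext y
      simp only [Pi.add_apply, hv]
      ring
    rw [hfun] at h
    rw [h.fderiv]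
    simp [EuclideanSpace.inner_single_right]
  have hgrad := fderiv_eq_of_det_hessian_eq_one hOo hOconv.isPreconnected huA hdet
    (fun x hx => by linarith [htr x hx]) (hsub hx₀) (by
      filter_upwards [hev.eventually_nhds, hOo.mem_nhds (hsub hx₀)] with x hx hxO i
      have h0 : v =ᶠ[𝓝 x] fun _ => 0 := hx
      rw [hfd x hxO, h0.fderiv_eq]
      simp)
  have hvgrad : EqOn (fderiv ℝ v) 0 O := by
    intro x hx
    have hi : ∀ i, fderiv ℝ v x (EuclideanSpace.single i 1) = 0 := fun i => by
      have := hfd x hx i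
      rw [hgrad x hx i] at this
      linarith
    ext y
    rw [EuclideanSpace.map_fin_two, hi, hi]
    simp
  have hvO : EqOn v (fun _ => 0) O := fun x hx =>
    (hOo.is_const_of_fderiv_eq_zero hOconv.isPreconnected
      (fun y hy => ((hvA y hy).differentiableAt (by simp)).differentiableWithinAt) hvgrad hx
      (hsub hx₀)).trans hvx₀
  exact hvO.of_subset_closure hvC.continuousOn continuousOn_const hOC subset_rfl
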